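/- Let $k\ge 1$ and let $\boldsymbol\beta=(\beta_1,\dots,\beta_k)$ be constants with $\beta_i>0$ and $\beta_1+\cdots+\beta_k=1$. Then there is a constant $K_0=K_0(\boldsymbol\beta)$ such that for every constant $K\ge K_0$ the following holds with $p=K\log n/n$. Let each vertex $v\in[n]$ have a fixed colour $c(v)\in[k]$, such that $V_i=\{v: c(v)=i\}$ has $\beta_i n$ elements, rounded up or down if $\beta_i n$ is not an integer (that is, $\bigl||V_i|-\beta_i n\bigr|<1$), for $i\in[k]$. Let $\mathbf c=(c_1,\dots,c_n)\in[k]^n$ be an arbitrary sequence of colours in which each colour $i$ appears exactly $|V_i|$ times. Then with high probability the binomial random graph $G_{n,p}$ on $[n]$ contains a Hamilton cycle $(x_1,x_2,\dots,x_n,x_1)$ with $c(x_i)=c_i$ for $i=1,\dots,n$. That is, the probability of this event is at least $1-\varepsilon$ for every $\varepsilon>0$ and all $n\ge n_0(\boldsymbol\beta,K,\varepsilon)$, uniformly over the colourings and the sequences $\mathbf c$. -/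

import Mathlib

/-- The edge probability `K log n / n`, truncated to `[0, 1]`
(for `K ≥ 0` the truncation is inactive for all large `n`). -/
noncomputable def edgeProb (K : ℝ) (n : ℕ) : unitInterval :=
  Set.projIcc (0 : ℝ) 1 zero_le_one (K * Real.log n / n)

/-- Given a vertex colouring `col` and a colour pattern `c = (c₁, …, cₙ)`, the graph `G` on `n`
vertices has a Hamilton cycle `(x₁, x₂, …, xₙ, x₁)` with `col xᵢ = cᵢ` for all `i`
(positions are indexed from `0`). -/
def HasColoredHamiltonCycle {n k : ℕ} (G : SimpleGraph (Fin n)) (col : Fin n → Fin k)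
    (c : Fin n → Fin k) : Prop :=
  ∃ (v : Fin n) (x : G.Walk v v), x.IsHamiltonianCycle ∧ ∀ i : Fin n, col (x.getVert i) = c i

/-! Consider all bijections σ from positions to vertices that respect the colour pattern, each
giving a candidate cycle `cycleEdges σ`. If every colour class has at least b = δn vertices,
prescribing σ at m points keeps at most a (3/b)^m fraction of them. Since a set of edges pins down
the positions of its endpoints up to few choices, the candidate cycles form a q-spread family with q
= O(1/n) (`isSpread_cycleEdges`).

A random set of density of order q log n contains a member of such a family with high probability
(`bernoulliExpect_uncovered_le`). The proof uses minimum fragments: expose W of density 64q and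
replace each member by what W misses of the nearest member inside W ∪ T σ. Most fragments have at
most half the maximal size, and spreadness passes to subsets. After r = ⌈log₂ n⌉ rounds the
surviving sizes are at most √r, and a last round of density rq captures a whole fragment except with
probability o(1). The total density is at most 65rq = O(log n / n). -/

open Finset

/-! ### Binomial random subsets as finite weighted sums -/

section BernoulliExpect

variable {α : Type*}

/-- The expectation of `F W`, where `W` is a random subset of `u` that contains each element
of `u` independently with probability `p`. -/
noncomputable def bernoulliExpect (p : ℝ) (u : Finset α) (F : Finset α → ℝ) : ℝ :=
  ∑ W ∈ u.powerset, p ^ #W * (1 - p) ^ (#u - #W) * F W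

theorem bernoulliExpect_mono {p : ℝ} (hp0 : 0 ≤ p) (hp1 : p ≤ 1) {u : Finset α}
    {F G : Finset α → ℝ} (h : ∀ W ⊆ u, F W ≤ G W) :
    bernoulliExpect p u F ≤ bernoulliExpect p u G := by
  refine sum_le_sum fun W hW ↦ mul_le_mul_of_nonneg_left (h W (mem_powerset.1 hW)) ?_
  have : 0 ≤ 1 - p := by linarith
  positivity

theorem bernoulliExpect_add (p : ℝ) (u : Finset α) (F G : Finset α → ℝ) :
    bernoulliExpect p u (fun W ↦ F W + G W) = bernoulliExpect p u F + bernoulliExpect p u G := by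
  simp only [bernoulliExpect, mul_add, sum_add_distrib]

theorem bernoulliExpect_sum {ι : Type*} (s : Finset ι) (p : ℝ) (u : Finset α)
    (F : ι → Finset α → ℝ) :
    bernoulliExpect p u (fun W ↦ ∑ i ∈ s, F i W) = ∑ i ∈ s, bernoulliExpect p u (F i) := by
  simp only [bernoulliExpect, mul_sum]
  exact sum_comm

theorem bernoulliExpect_mul_const (p : ℝ) (u : Finset α) (F : Finset α → ℝ) (b : ℝ) :
    bernoulliExpect p u (fun W ↦ F W * b) = bernoulliExpect p u F * b := by
  simp only [bernoulliExpect, sum_mul, mul_assoc]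

variable [DecidableEq α]

/-- Condition on whether a is chosen. The inductions on u rest on this recursion. -/
theorem bernoulliExpect_insert (p : ℝ) {a : α} {u : Finset α} (ha : a ∉ u)
    (F : Finset α → ℝ) :
    bernoulliExpect p (insert a u) F =
      (1 - p) * bernoulliExpect p u F + p * bernoulliExpect p u (fun W ↦ F (insert a W)) := by
  unfold bernoulliExpect
  rw [sum_powerset_insert ha, mul_sum, mul_sum]
  congr 1
  · refine sum_congr rfl fun W hW ↦ ?_
    have h := card_le_card (mem_powerset.1 hW)
    rw [card_insert_of_notMem ha, Nat.sub_add_comm h, pow_succ]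
    ring
  · refine sum_congr rfl fun W hW ↦ ?_
    have h : a ∉ W := fun h ↦ ha (mem_powerset.1 hW h)
    rw [card_insert_of_notMem ha, card_insert_of_notMem h, Nat.add_sub_add_right, pow_succ]
    ring

theorem bernoulliExpect_const (p : ℝ) (u : Finset α) (b : ℝ) :
    bernoulliExpect p u (fun _ ↦ b) = b := by
  induction u using Finset.induction_on with
  | empty => simp [bernoulliExpect]
  | insert a u ha ih => rw [bernoulliExpect_insert p ha, ih]; ring

/-- The union of two independent binomial random sets is a binomial random set. -/
theorem bernoulliExpect_union (p p' : ℝ) (u : Finset α) (F : Finset α → ℝ) :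
    bernoulliExpect p u (fun W ↦ bernoulliExpect p' u (fun W' ↦ F (W ∪ W'))) =
      bernoulliExpect (p + p' - p * p') u F := by
  induction u using Finset.induction_on generalizing F with
  | empty => simp [bernoulliExpect]
  | insert a u ha ih =>
    simp only [bernoulliExpect_insert _ ha, union_insert, insert_union, insert_idem,
      bernoulliExpect_add, ih, mul_comm _ (bernoulliExpect _ _ _), bernoulliExpect_mul_const]
    rw [ih (fun W ↦ F (insert a W))]
    ring

/-- Sprinkling: density p' is reached from p by adding an independent set of density (p' - p)/(1 -
p), which can only decrease F. -/
theorem bernoulliExpect_anti {p p' : ℝ} (hp0 : 0 ≤ p) (hpp : p ≤ p') (hp1 : p' ≤ 1)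
    {u : Finset α} {F : Finset α → ℝ} (h : ∀ W W', F (W ∪ W') ≤ F W) :
    bernoulliExpect p' u F ≤ bernoulliExpect p u F := by
  rcases hpp.eq_or_lt with rfl | hlt
  · rfl
  have h1 : 0 < 1 - p := by linarith
  have key : p' = p + (p' - p) / (1 - p) - p * ((p' - p) / (1 - p)) := by
    field_simp
    ring
  rw [key, ← bernoulliExpect_union]
  refine bernoulliExpect_mono hp0 (by linarith) fun W _ ↦ ?_
  rw [← bernoulliExpect_const ((p' - p) / (1 - p)) u (F W)]
  refine bernoulliExpect_mono (by apply div_nonneg <;> linarith) ?_ fun W' _ ↦ h W W'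
  rw [div_le_one h1]
  linarith

end BernoulliExpect

/-! ### Spread families and minimum fragments -/

section Fragment

variable {α Ω : Type*} [DecidableEq α]

/-- The family `T σ`, `σ ∈ s`, is `q`-spread, relative to the total mass `N`. -/
def IsSpread (s : Finset Ω) (T : Ω → Finset α) (q N : ℝ) : Prop :=
  ∀ S : Finset α, (#{σ ∈ s | S ⊆ T σ} : ℝ) ≤ q ^ #S * N

theorem IsSpread.card_le {s : Finset Ω} {T : Ω → Finset α} {q N : ℝ} (h : IsSpread s T q N) :
    (#s : ℝ) ≤ N := by
  simpa [IsSpread] using h ∅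

/-- N stays fixed while the family loses members and its sets shrink, so fragments can serve as the
family of the next round. -/
theorem IsSpread.mono {s s' : Finset Ω} {T T' : Ω → Finset α} {q N : ℝ} (h : IsSpread s T q N)
    (hs : s' ⊆ s) (hT : ∀ σ ∈ s', T' σ ⊆ T σ) : IsSpread s' T' q N := by
  intro S
  refine le_trans ?_ (h S)
  gcongr
  intro σ hσ
  rw [mem_filter] at hσ ⊢
  exact ⟨hs hσ.1, hσ.2.trans (hT σ hσ.1)⟩

/-- Minimum fragments: `R W σ` is what is missing from `W` in the member of the family contained in
`W ∪ T σ` that is nearest to `W`. -/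
theorem exists_fragment (s : Finset Ω) (T : Ω → Finset α) :
    ∃ R : Finset α → Ω → Finset α,
      (∀ W, ∀ σ ∈ s, R W σ ⊆ T σ ∧ Disjoint (R W σ) W ∧ ∃ σ' ∈ s, T σ' ⊆ W ∪ R W σ) ∧
      ∀ Z : Finset α, ∃ S : Finset α, (S = ∅ ∨ ∃ σ ∈ s, S = T σ) ∧
        ∀ W, ∀ σ ∈ s, W ∪ R W σ = Z → R W σ ⊆ S := by
  classical
  have hmin : ∀ W : Finset α, ∀ σ : Ω, ∃ σ', σ ∈ s → (σ' ∈ s ∧ T σ' ⊆ W ∪ T σ ∧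
      ∀ τ ∈ s, T τ ⊆ W ∪ T σ → #(T σ' \ W) ≤ #(T τ \ W)) := by
    intro W σ
    by_cases hσ : σ ∈ s
    · obtain ⟨σ', h1, h2⟩ := exists_min_image {τ ∈ s | T τ ⊆ W ∪ T σ} (fun τ ↦ #(T τ \ W))
        ⟨σ, by simp [hσ]⟩
      simp only [mem_filter] at h1 h2
      exact ⟨σ', fun _ ↦ ⟨h1.1, h1.2, fun τ h3 h4 ↦ h2 τ ⟨h3, h4⟩⟩⟩
    · exact ⟨σ, fun h ↦ absurd h hσ⟩
  choose g hg using hmin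
  refine ⟨fun W σ ↦ T (g W σ) \ W, fun W σ hσ ↦ ⟨?_, sdiff_disjoint, g W σ, (hg W σ hσ).1, ?_⟩, ?_⟩
  · have := (hg W σ hσ).2.1
    grind
  · simp [subset_union_right]
  · intro Z
    by_cases hZ : ∃ σ ∈ s, T σ ⊆ Z
    · obtain ⟨τ, hτ, hτZ⟩ := hZ
      refine ⟨T τ, Or.inr ⟨τ, hτ, rfl⟩, fun W σ hσ hW ↦ ?_⟩
      obtain ⟨_, h2, h3⟩ := hg W σ hσ
      -- τ depends on Z alone. As T τ ⊆ Z, its part outside W lies in the fragment; minimality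
      -- forces equality, so the fragment lies in T τ.
      have hsub : T τ \ W ⊆ T (g W σ) \ W := by grind
      have hle := h3 τ hτ (by grind)
      have heq := eq_of_subset_of_card_le hsub hle
      change T (g W σ) \ W ⊆ T τ
      rw [← heq]
      exact sdiff_subset
    · refine ⟨∅, Or.inl rfl, fun W σ hσ hW ↦ absurd ?_ hZ⟩
      exact ⟨g W σ, (hg W σ hσ).1, by rw [← hW]; simp [subset_union_right]⟩

/-- The expected number of fragments of size `t` is small. -/
theorem bernoulliExpect_card_fragment_le {s : Finset Ω} {T : Ω → Finset α} {q N : ℝ} {l : ℕ}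
    (hspread : IsSpread s T q N) {u : Finset α} (hu : ∀ σ ∈ s, T σ ⊆ u) (hl : ∀ σ ∈ s, #(T σ) ≤ l)
    (hq : 0 ≤ q) {R : Finset α → Ω → Finset α}
    (hR : ∀ W, ∀ σ ∈ s, R W σ ⊆ T σ ∧ Disjoint (R W σ) W)
    (hRS : ∀ Z : Finset α, ∃ S : Finset α, (S = ∅ ∨ ∃ σ ∈ s, S = T σ) ∧
        ∀ W, ∀ σ ∈ s, W ∪ R W σ = Z → R W σ ⊆ S)
    {p : ℝ} (hp0 : 0 ≤ p) (hp1 : p ≤ 1) (t : ℕ) :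
    bernoulliExpect p u (fun W ↦ (#{σ ∈ s | #(R W σ) = t} : ℝ)) * p ^ t ≤
      l.choose t * q ^ t * N := by
  classical
  choose S hS hSR using hRS
  have hN : 0 ≤ N := (Nat.cast_nonneg _).trans hspread.card_le
  have hp1' : 0 ≤ 1 - p := by linarith
  set w : Finset α → ℝ := fun W ↦ p ^ #W * (1 - p) ^ (#u - #W) with hw
  have hw0 : ∀ W, 0 ≤ w W := fun W ↦ by positivity
  -- Adding t new elements multiplies the weight by p^t and removes factors 1 - p ≤ 1.
  have hweight : ∀ σ ∈ s, ∀ W ⊆ u, #(R W σ) = t → w W * p ^ t ≤ w (W ∪ R W σ) := by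
    intro σ hσ W hW ht
    have hdisj := (hR W σ hσ).2
    have hcard : #(W ∪ R W σ) = #W + t := by
      rw [card_union_of_disjoint hdisj.symm, ht]
    simp only [hw, hcard, pow_add]
    have : (1 - p) ^ (#u - #W) ≤ (1 - p) ^ (#u - (#W + t)) :=
      pow_le_pow_of_le_one hp1' (by linarith) (by omega)
    calc p ^ #W * (1 - p) ^ (#u - #W) * p ^ t = p ^ #W * p ^ t * (1 - p) ^ (#u - #W) := by ring
      _ ≤ _ := by gcongr
  have step1 : bernoulliExpect p u (fun W ↦ (#{σ ∈ s | #(R W σ) = t} : ℝ)) * p ^ t ≤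
      ∑ x ∈ (u.powerset ×ˢ s) with #(R x.1 x.2) = t, w (x.1 ∪ R x.1 x.2) := by
    rw [sum_filter, sum_product, bernoulliExpect, sum_mul]
    refine sum_le_sum fun W hW ↦ ?_
    rw [mem_powerset] at hW
    rw [card_filter, Nat.cast_sum, mul_sum, sum_mul]
    refine sum_le_sum fun σ hσ ↦ ?_
    by_cases ht : #(R W σ) = t
    · simpa [ht] using hweight σ hσ W hW ht
    · simp [ht]
  -- Encode (W, σ) by Z = W ∪ R, the fragment A = R and σ; this is injective because W = Z \ R.
  -- Given Z, A is a t-subset of S Z, and spreadness bounds the σ with A ⊆ T σ.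
  have step2 : ∑ x ∈ (u.powerset ×ˢ s) with #(R x.1 x.2) = t, w (x.1 ∪ R x.1 x.2) ≤
      ∑ y ∈ u.powerset.sigma fun Z ↦ ((S Z).powersetCard t).sigma fun A ↦ {σ ∈ s | A ⊆ T σ},
        w y.1 := by
    rw [← sum_image (f := fun y : (_ : Finset α) × (_ : Finset α) × Ω ↦ w y.1)
      (g := fun x : Finset α × Ω ↦ ⟨x.1 ∪ R x.1 x.2, R x.1 x.2, x.2⟩)]
    · refine sum_le_sum_of_subset_of_nonneg ?_ fun y _ _ ↦ hw0 _
      intro y hy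
      obtain ⟨⟨W, σ⟩, hx, rfl⟩ := mem_image.1 hy
      simp only [mem_filter, mem_product, mem_powerset] at hx
      obtain ⟨⟨hW, hσ⟩, ht⟩ := hx
      simp only [mem_sigma, mem_powerset, mem_powersetCard, mem_filter]
      exact ⟨union_subset hW ((hR W σ hσ).1.trans (hu σ hσ)), ⟨hSR _ W σ hσ rfl, ht⟩, hσ,
        (hR W σ hσ).1⟩
    · rintro ⟨W, σ⟩ hx ⟨W', σ'⟩ hx' h
      simp only [coe_filter, mem_product, mem_powerset, Set.mem_ofPred_eq] at hx hx'
      simp only [Sigma.mk.injEq, heq_eq_eq] at h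
      obtain ⟨h1, h2, rfl⟩ := h
      have hd := (hR W σ hx.1.2).2
      have hd' := (hR W' σ hx'.1.2).2
      have e1 : W = (W ∪ R W σ) \ R W σ := (union_sdiff_cancel_right hd.symm).symm
      have e2 : W' = (W' ∪ R W' σ) \ R W' σ := (union_sdiff_cancel_right hd'.symm).symm
      rw [e1, e2, h1, h2]
  refine step1.trans (step2.trans ?_)
  rw [sum_sigma]
  calc ∑ Z ∈ u.powerset, ∑ y ∈ ((S Z).powersetCard t).sigma fun A ↦ {σ ∈ s | A ⊆ T σ}, w Z
      ≤ ∑ Z ∈ u.powerset, w Z * (l.choose t * q ^ t * N) := by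
        refine sum_le_sum fun Z _ ↦ ?_
        rw [sum_const, nsmul_eq_mul, mul_comm]
        refine mul_le_mul_of_nonneg_left ?_ (hw0 Z)
        rw [card_sigma, Nat.cast_sum]
        have hSl : #(S Z) ≤ l := by
          rcases hS Z with h | ⟨σ, hσ, h⟩
          · simp [h]
          · rw [h]; exact hl σ hσ
        calc ∑ A ∈ (S Z).powersetCard t, (#{σ ∈ s | A ⊆ T σ} : ℝ)
            ≤ ∑ A ∈ (S Z).powersetCard t, q ^ t * N := by
              refine sum_le_sum fun A hA ↦ ?_
              rw [← (mem_powersetCard.1 hA).2]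
              exact hspread A
          _ = (#(S Z)).choose t * q ^ t * N := by
              rw [sum_const, card_powersetCard, nsmul_eq_mul, mul_assoc]
          _ ≤ l.choose t * q ^ t * N := by gcongr
    _ = l.choose t * q ^ t * N := bernoulliExpect_const p u _

end Fragment

/-! ### Random sets contain a member of a spread family -/

section SpreadThreshold

variable {α Ω : Type*} [DecidableEq α]

/-- The indicator of the event that `W` contains no member of the family `T σ`, `σ ∈ s`. -/
noncomputable def uncovered (s : Finset Ω) (T : Ω → Finset α) (W : Finset α) : ℝ :=
  if ∃ σ ∈ s, T σ ⊆ W then 0 else 1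

theorem uncovered_le_of_imp {Ω' : Type*} {s : Finset Ω} {T : Ω → Finset α} {s' : Finset Ω'}
    {T' : Ω' → Finset α} {W W' : Finset α}
    (h : (∃ σ ∈ s', T' σ ⊆ W') → ∃ σ ∈ s, T σ ⊆ W) : uncovered s T W ≤ uncovered s' T' W' := by
  unfold uncovered
  split_ifs with h1 h2 h2
  · rfl
  · exact zero_le_one
  · exact absurd (h h2) h1
  · rfl

/-- A first-moment bound: if W contains no member, then all #s fragments are nonempty. The term 1 -
#s/N pays for members already discarded. -/
theorem bernoulliExpect_uncovered_base {s : Finset Ω} {T : Ω → Finset α} {q N : ℝ} {m : ℕ}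
    (hspread : IsSpread s T q N) {u : Finset α} (hu : ∀ σ ∈ s, T σ ⊆ u) (hm : ∀ σ ∈ s, #(T σ) ≤ m)
    (hq : 0 ≤ q) (hN : 0 < N) {p : ℝ} (hp0 : 0 < p) (hp1 : p ≤ 1) :
    bernoulliExpect p u (uncovered s T) ≤ 1 - #s / N + ((1 + q / p) ^ m - 1) := by
  obtain ⟨R, hR, hRS⟩ := exists_fragment s T
  have hfrag := bernoulliExpect_card_fragment_le hspread hu hm hq
    (fun W σ hσ ↦ ⟨(hR W σ hσ).1, (hR W σ hσ).2.1⟩) hRS hp0.le hp1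
  have hpoint : ∀ W ⊆ u, uncovered s T W ≤
      (1 - #s / N) + (∑ t ∈ Icc 1 m, (#{σ ∈ s | #(R W σ) = t} : ℝ)) * N⁻¹ := by
    intro W _
    have hsN : (#s : ℝ) / N ≤ 1 := (div_le_one hN).2 hspread.card_le
    unfold uncovered
    split_ifs with h
    · have : 0 ≤ (∑ t ∈ Icc 1 m, (#{σ ∈ s | #(R W σ) = t} : ℝ)) * N⁻¹ := by positivity
      linarith
    · have hsum : (∑ t ∈ Icc 1 m, (#{σ ∈ s | #(R W σ) = t} : ℝ)) = #s := by
        rw [← Nat.cast_sum, ← card_eq_sum_card_fiberwise]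
        intro σ hσ
        simp only [coe_Icc, Set.mem_Icc]
        refine ⟨?_, (card_le_card (hR W σ hσ).1).trans (hm σ hσ)⟩
        rw [Nat.one_le_iff_ne_zero]
        intro h0
        obtain ⟨σ', hσ', hsub⟩ := (hR W σ hσ).2.2
        rw [card_eq_zero.1 h0, union_empty] at hsub
        exact h ⟨σ', hσ', hsub⟩
      rw [hsum, div_eq_mul_inv]
      linarith
  refine (bernoulliExpect_mono hp0.le hp1 hpoint).trans ?_
  rw [bernoulliExpect_add, bernoulliExpect_const, bernoulliExpect_mul_const, bernoulliExpect_sum]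
  gcongr
  rw [← div_eq_mul_inv, div_le_iff₀ hN]
  calc ∑ t ∈ Icc 1 m, bernoulliExpect p u (fun W ↦ (#{σ ∈ s | #(R W σ) = t} : ℝ))
      ≤ ∑ t ∈ Icc 1 m, (q / p) ^ t * m.choose t * N := by
        refine sum_le_sum fun t _ ↦ ?_
        have := hfrag t
        rw [← le_div_iff₀ (by positivity)] at this
        refine this.trans_eq ?_
        rw [div_pow]
        ring
    _ = ((1 + q / p) ^ m - 1) * N := by
        rw [← sum_mul, add_comm 1, add_pow, range_eq_Ico, sum_eq_sum_Ico_succ_bot (by omega)]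
        simp only [one_pow, mul_one, pow_zero, Nat.choose_zero_right, Nat.cast_one, zero_add]
        rw [add_sub_cancel_left]
        rfl

/-- One round of exposing a binomial random set: most fragments have at most half the size. -/
theorem bernoulliExpect_card_large_fragment_le {s : Finset Ω} {T : Ω → Finset α} {q N : ℝ} {l : ℕ}
    (hspread : IsSpread s T q N) {u : Finset α} (hu : ∀ σ ∈ s, T σ ⊆ u) (hl : ∀ σ ∈ s, #(T σ) ≤ l)
    (hq : 0 < q) (hq1 : 64 * q ≤ 1) (hN : 0 < N) {R : Finset α → Ω → Finset α}
    (hR : ∀ W, ∀ σ ∈ s, R W σ ⊆ T σ ∧ Disjoint (R W σ) W)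
    (hRS : ∀ Z : Finset α, ∃ S : Finset α, (S = ∅ ∨ ∃ σ ∈ s, S = T σ) ∧
        ∀ W, ∀ σ ∈ s, W ∪ R W σ = Z → R W σ ⊆ S) :
    bernoulliExpect (64 * q) u (fun W ↦ (#{σ ∈ s | l < 2 * #(R W σ)} : ℝ)) ≤ (1 / 4) ^ l * N := by
  have hfrag := bernoulliExpect_card_fragment_le hspread hu hl hq.le hR hRS (by positivity) hq1
  have hpoint : ∀ W ⊆ u, (#{σ ∈ s | l < 2 * #(R W σ)} : ℝ) ≤
      ∑ t ∈ {t ∈ range (l + 1) | l < 2 * t}, (#{σ ∈ s | #(R W σ) = t} : ℝ) := by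
    intro W _
    rw [card_eq_sum_card_fiberwise (f := fun σ ↦ #(R W σ))
      (t := {t ∈ range (l + 1) | l < 2 * t}), Nat.cast_sum]
    · refine sum_le_sum fun t _ ↦ ?_
      gcongr
      exact filter_subset _ _
    · intro σ hσ
      simp only [coe_filter, Set.mem_ofPred_eq, mem_range] at hσ ⊢
      exact ⟨Nat.lt_succ_of_le ((card_le_card (hR W σ hσ.1).1).trans (hl σ hσ.1)), hσ.2⟩
  refine (bernoulliExpect_mono (by positivity) hq1 hpoint).trans ?_
  rw [bernoulliExpect_sum]
  calc ∑ t ∈ {t ∈ range (l + 1) | l < 2 * t},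
        bernoulliExpect (64 * q) u (fun W ↦ (#{σ ∈ s | #(R W σ) = t} : ℝ))
      ≤ ∑ t ∈ {t ∈ range (l + 1) | l < 2 * t}, l.choose t * ((1 / 8) ^ l * N) := by
        refine sum_le_sum fun t ht ↦ ?_
        have h := hfrag t
        rw [← le_div_iff₀ (by positivity)] at h
        -- Here 2t > l. The binomial coefficients then add up to 2^l, leaving (1/4)^l.
        have hpow : ((1 : ℝ) / 64) ^ t ≤ (1 / 8) ^ l := by
          rw [show (1 : ℝ) / 64 = (1 / 8) ^ 2 by norm_num, ← pow_mul]
          exact pow_le_pow_of_le_one (by norm_num) (by norm_num) (mem_filter.1 ht).2.le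
        calc _ ≤ _ := h
          _ = l.choose t * ((1 / 64) ^ t * N) := by
              rw [mul_pow, div_pow, one_pow]
              field_simp
          _ ≤ _ := by gcongr
    _ ≤ ∑ t ∈ range (l + 1), l.choose t * ((1 / 8) ^ l * N) :=
        sum_le_sum_of_subset_of_nonneg (filter_subset _ _) fun _ _ _ ↦ by positivity
    _ = (1 / 4) ^ l * N := by
        rw [← sum_mul, ← Nat.cast_sum, Nat.sum_range_choose, ← mul_assoc, Nat.cast_pow, ← mul_pow]
        norm_num

/-- The edge density after `r` rounds of density `a` and a last round of density `b`. -/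
noncomputable def roundsDensity (a b : ℝ) : ℕ → ℝ
  | 0 => b
  | r + 1 => a + roundsDensity a b r - a * roundsDensity a b r

theorem roundsDensity_mem {a b : ℝ} (ha0 : 0 ≤ a) (ha1 : a ≤ 1) (hb0 : 0 ≤ b) (hb1 : b ≤ 1)
    (r : ℕ) : 0 ≤ roundsDensity a b r ∧ roundsDensity a b r ≤ 1 ∧
      roundsDensity a b r ≤ r * a + b := by
  induction r with
  | zero => simp [roundsDensity, hb0, hb1]
  | succ r ih =>
    obtain ⟨h0, h1, h2⟩ := ih
    simp only [roundsDensity, Nat.cast_add, Nat.cast_one]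
    refine ⟨?_, ?_, ?_⟩ <;> nlinarith

/-- The probability that a binomial random set contains no member of a spread family. -/
theorem bernoulliExpect_uncovered_le {q N : ℝ} {m : ℕ} (hq : 0 < q) (hq1 : 64 * q ≤ 1)
    (hN : 0 < N) {p : ℝ} (hp0 : 0 < p) (hp1 : p ≤ 1) {u : Finset α} (r : ℕ) {s : Finset Ω}
    {T : Ω → Finset α} (hspread : IsSpread s T q N) (hu : ∀ σ ∈ s, T σ ⊆ u)
    (hm : ∀ σ ∈ s, #(T σ) ≤ m * 2 ^ r) :
    bernoulliExpect (roundsDensity (64 * q) p r) u (uncovered s T) ≤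
      1 - #s / N + (r * (1 / 4) ^ m + ((1 + q / p) ^ m - 1)) := by
  induction r generalizing s T with
  | zero =>
    simpa [roundsDensity] using
      bernoulliExpect_uncovered_base hspread hu (by simpa using hm) hq.le hN hp0 hp1
  | succ r ih =>
    obtain ⟨R, hR, hRS⟩ := exists_fragment s T
    have hlarge := bernoulliExpect_card_large_fragment_le hspread hu hm hq hq1 hN
      (fun W σ hσ ↦ ⟨(hR W σ hσ).1, (hR W σ hσ).2.1⟩) hRS
    set err : ℝ := r * (1 / 4) ^ m + ((1 + q / p) ^ m - 1) with herr
    have hround : ∀ W ⊆ u, bernoulliExpect (roundsDensity (64 * q) p r) u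
        (fun W' ↦ uncovered s T (W ∪ W')) ≤
        (1 - #s / N + err) + (#{σ ∈ s | m * 2 ^ (r + 1) < 2 * #(R W σ)} : ℝ) * N⁻¹ := by
      intro W _
      obtain ⟨hd0, hd1, -⟩ := roundsDensity_mem (a := 64 * q) (by positivity) hq1 hp0.le hp1 r
      have hsub : {σ ∈ s | ¬ m * 2 ^ (r + 1) < 2 * #(R W σ)} ⊆ s := filter_subset _ _
      -- Recurse on the small fragments only; the discarded large ones increase the deficit 1 -
      -- #s/N, by at most (1/4)^m in expectation.
      have h := ih (s := {σ ∈ s | ¬ m * 2 ^ (r + 1) < 2 * #(R W σ)}) (T := R W)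
        (hspread.mono hsub fun σ hσ ↦ (hR W σ (hsub hσ)).1)
        (fun σ hσ ↦ (hR W σ (hsub hσ)).1.trans (hu σ (hsub hσ)))
        (fun σ hσ ↦ by
          have := (mem_filter.1 hσ).2
          rw [pow_succ, ← mul_assoc] at this
          omega)
      have hcard : (#{σ ∈ s | ¬ m * 2 ^ (r + 1) < 2 * #(R W σ)} : ℝ) =
          #s - #{σ ∈ s | m * 2 ^ (r + 1) < 2 * #(R W σ)} := by
        rw [eq_sub_iff_add_eq', ← Nat.cast_add, card_filter_add_card_filter_not]
      refine (bernoulliExpect_mono hd0 hd1 fun W' _ ↦ ?_).trans (h.trans_eq ?_)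
      · refine uncovered_le_of_imp fun ⟨σ, hσ, hσW⟩ ↦ ?_
        obtain ⟨σ', hσ', hsub'⟩ := (hR W σ (hsub hσ)).2.2
        exact ⟨σ', hσ', hsub'.trans (union_subset_union_right hσW)⟩
      · rw [hcard]
        ring
    have hpow : ((1 : ℝ) / 4) ^ (m * 2 ^ (r + 1)) ≤ (1 / 4) ^ m :=
      pow_le_pow_of_le_one (by norm_num) (by norm_num)
        (Nat.le_mul_of_pos_right _ (by positivity))
    rw [roundsDensity, ← bernoulliExpect_union]
    refine (bernoulliExpect_mono (by positivity) hq1 hround).trans ?_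
    rw [bernoulliExpect_add, bernoulliExpect_const, bernoulliExpect_mul_const]
    have : bernoulliExpect (64 * q) u
        (fun W ↦ (#{σ ∈ s | m * 2 ^ (r + 1) < 2 * #(R W σ)} : ℝ)) * N⁻¹ ≤ (1 / 4) ^ m := by
      rw [← div_eq_mul_inv, div_le_iff₀ hN]
      exact hlarge.trans (by gcongr)
    push_cast
    linarith

end SpreadThreshold

/-! ### Factorial estimates -/

theorem pow_le_three_pow_mul_descFactorial (a m : ℕ) (h : m ≤ a) :
    a ^ m ≤ 3 ^ m * a.descFactorial m := by
  induction a generalizing m with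
  | zero => simp [Nat.le_zero.1 h]
  | succ a ih =>
    cases m with
    | zero => simp
    | succ m =>
      have hm : m ≤ a := by omega
      -- Since m ≤ a, (1 + 1/a)^m ≤ e < 3.
      have key : (a + 1) ^ m ≤ 3 * a ^ m := by
        rcases Nat.eq_zero_or_pos a with rfl | ha
        · simp [Nat.le_zero.1 hm]
        · have ha' : (0 : ℝ) < a := by exact_mod_cast ha
          have h1 : (1 + (a : ℝ)⁻¹) ^ m ≤ 3 := by
            calc (1 + (a : ℝ)⁻¹) ^ m ≤ (1 + (a : ℝ)⁻¹) ^ a :=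
                  pow_le_pow_right₀ (by simp) hm
              _ ≤ Real.exp 1 := Real.one_add_inv_pow_le_exp
              _ ≤ 3 := Real.exp_one_lt_three.le
          have h2 : ((a : ℝ) + 1) ^ m = (1 + (a : ℝ)⁻¹) ^ m * a ^ m := by
            rw [← mul_pow]
            congr 1
            field_simp
          have : ((a : ℝ) + 1) ^ m ≤ 3 * a ^ m := by
            rw [h2]
            gcongr
          exact_mod_cast this
      calc (a + 1) ^ (m + 1) = (a + 1) * (a + 1) ^ m := by ring
        _ ≤ (a + 1) * (3 * a ^ m) := by gcongr
        _ ≤ (a + 1) * (3 * (3 ^ m * a.descFactorial m)) := by gcongr; exact ih m hm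
        _ = 3 ^ (m + 1) * (a + 1).descFactorial (m + 1) := by
            rw [Nat.succ_descFactorial_succ]; ring

theorem factorial_sub_mul_pow_le {b : ℝ} (hb : 0 ≤ b) {a m : ℕ} (hba : b ≤ a) (h : m ≤ a) :
    ((a - m).factorial : ℝ) * (b / 3) ^ m ≤ a.factorial := by
  have h1 : (a : ℝ) ^ m ≤ 3 ^ m * a.descFactorial m := by
    exact_mod_cast pow_le_three_pow_mul_descFactorial a m h
  rw [← Nat.factorial_mul_descFactorial h, Nat.cast_mul, div_pow]
  gcongr
  rw [div_le_iff₀ (by positivity), mul_comm]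
  exact le_trans (by gcongr) h1

/-! ### Counting bijections that follow a colour pattern -/

section PatternPerm

variable {V κ : Type*} [Fintype V] [DecidableEq V] [DecidableEq κ]

/-- The bijections from positions to vertices under which the vertex colours follow
the pattern `c`. -/
def patternPerms (col c : V → κ) : Finset (Equiv.Perm V) :=
  {σ | ∀ x, col (σ x) = c x}

theorem mem_patternPerms {col c : V → κ} {σ : Equiv.Perm V} :
    σ ∈ patternPerms col c ↔ ∀ x, col (σ x) = c x := by
  simp [patternPerms]

theorem patternPerms_nonempty {col c : V → κ}
    (h : ∀ i, #{x | c x = i} = #{v | col v = i}) : (patternPerms col c).Nonempty := by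
  have e : ∀ i, Nonempty ({x // c x = i} ≃ {v // col v = i}) := fun i ↦ by
    rw [← Fintype.card_eq, Fintype.card_subtype, Fintype.card_subtype]
    exact h i
  exact ⟨Equiv.ofFiberEquiv fun i ↦ (e i).some,
    mem_patternPerms.2 fun x ↦ Equiv.ofFiberEquiv_map _ x⟩

variable [Fintype κ]

/-- Composing σ₁ with any colour-preserving permutation of the vertices again follows the pattern.
-/
theorem card_patternPerms_ge {col c : V → κ} {σ₁ : Equiv.Perm V} (h₁ : σ₁ ∈ patternPerms col c) :
    ∏ i, (#{v | col v = i}).factorial ≤ #(patternPerms col c) := by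
  simp only [← Fintype.card_subtype]
  rw [← DomMulAct.stabilizer_card, Fintype.card_subtype]
  refine card_le_card_of_injOn (fun π ↦ π * σ₁) (fun π hπ ↦ ?_) ((mul_left_injective σ₁).injOn)
  rw [mem_coe, mem_patternPerms] at *
  intro x
  have hπ' : col ∘ π = col := by simpa using hπ
  rw [Equiv.Perm.mul_apply, ← h₁ x]
  exact congrFun hπ' (σ₁ x)

/-- Each σσ₁⁻¹ preserves colours and fixes the image of P pointwise, hence stabilizes the refined
colouring f in which every point of that image gets its own colour. -/
theorem card_patternPerms_eqOn_le {col c : V → κ} {σ₁ : Equiv.Perm V}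
    (h₁ : σ₁ ∈ patternPerms col c) (P : Finset V) :
    #{σ ∈ patternPerms col c | ∀ x ∈ P, σ x = σ₁ x} ≤
      ∏ i, (#{v | col v = i} - #{v ∈ P.image σ₁ | col v = i}).factorial := by
  set f : V → κ ⊕ V := fun y ↦ if y ∈ P.image σ₁ then Sum.inr y else Sum.inl (col y) with hf
  have hcard : #{σ ∈ patternPerms col c | ∀ x ∈ P, σ x = σ₁ x} ≤
      Fintype.card {π : Equiv.Perm V // f ∘ π = f} := by
    rw [Fintype.card_subtype]
    refine card_le_card_of_injOn (fun σ ↦ σ * σ₁⁻¹) (fun σ hσ ↦ ?_)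
      ((mul_left_injective σ₁⁻¹).injOn)
    simp only [coe_filter, Set.mem_ofPred_eq, mem_patternPerms] at hσ
    simp only [coe_filter, mem_univ, true_and, Set.mem_ofPred_eq]
    obtain ⟨hσ, hP⟩ := hσ
    rw [mem_patternPerms] at h₁
    have hfix : ∀ x ∈ P, (σ * σ₁⁻¹) (σ₁ x) = σ₁ x := fun x hx ↦ by
      simpa using hP x hx
    funext y
    obtain ⟨x, rfl⟩ := σ₁.surjective y
    have hval : (σ * σ₁⁻¹) (σ₁ x) = σ x := by simp
    have hmem : σ x ∈ P.image σ₁ ↔ σ₁ x ∈ P.image σ₁ := by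
      constructor
      · intro h
        obtain ⟨z, hz, hzx⟩ := mem_image.1 h
        rw [← hP z hz, σ.injective.eq_iff] at hzx
        exact mem_image_of_mem _ (hzx ▸ hz)
      · intro h
        obtain ⟨z, hz, hzx⟩ := mem_image.1 h
        rw [σ₁.injective.eq_iff] at hzx
        rw [hP x (hzx ▸ hz)]
        exact mem_image_of_mem _ (hzx ▸ hz)
    rw [Function.comp_apply, hval]
    by_cases h : σ₁ x ∈ P.image σ₁
    · have hx : x ∈ P := by
        obtain ⟨z, hz, hzx⟩ := mem_image.1 h
        exact σ₁.injective hzx ▸ hz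
      rw [hP x hx]
    · simp only [hf]
      rw [if_neg h, if_neg (mt hmem.1 h), hσ x, h₁ x]
  refine hcard.trans ?_
  rw [DomMulAct.stabilizer_card, Fintype.prod_sum_type]
  simp only [Fintype.card_subtype]
  rw [prod_eq_one (f := fun v : V ↦ (#{y | f y = Sum.inr v}).factorial), mul_one]
  · refine prod_le_prod' fun i _ ↦ Nat.factorial_le ?_
    rw [← card_sdiff_of_subset (filter_subset_filter _ (subset_univ _))]
    refine card_le_card fun y hy ↦ ?_
    simp only [hf, mem_filter, mem_univ, true_and] at hy
    split_ifs at hy with h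
    simp only [Sum.inl.injEq] at hy
    simp only [mem_sdiff, mem_filter, mem_univ, true_and]
    exact ⟨hy, fun h' ↦ h h'.1⟩
  · intro v _
    rw [Nat.factorial_eq_one]
    refine card_le_one.2 fun y hy z hz ↦ ?_
    simp only [hf, mem_filter, mem_univ, true_and] at hy hz
    split_ifs at hy hz
    simp only [Sum.inr.injEq] at hy hz
    rw [hy, hz]

theorem card_patternPerms_eqOn_mul_pow_le {col c : V → κ} {b : ℝ} (hb : 0 ≤ b)
    (hcol : ∀ i, b ≤ #{v | col v = i}) (P : Finset V) (g : V → V) :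
    (#{σ ∈ patternPerms col c | ∀ x ∈ P, σ x = g x} : ℝ) * (b / 3) ^ #P ≤
      #(patternPerms col c) := by
  rcases eq_empty_or_nonempty {σ ∈ patternPerms col c | ∀ x ∈ P, σ x = g x} with h0 | ⟨σ₁, h₁⟩
  · rw [h0]; simp
  rw [mem_filter] at h₁
  have heq : {σ ∈ patternPerms col c | ∀ x ∈ P, σ x = g x} =
      {σ ∈ patternPerms col c | ∀ x ∈ P, σ x = σ₁ x} :=
    filter_congr fun σ _ ↦ forall₂_congr fun x hx ↦ by rw [h₁.2 x hx]
  have hPcard : #P = ∑ i, #{v ∈ P.image σ₁ | col v = i} := by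
    rw [← card_image_of_injective P σ₁.injective]
    exact card_eq_sum_card_fiberwise fun _ _ ↦ mem_univ _
  have h3 : (#{σ ∈ patternPerms col c | ∀ x ∈ P, σ x = σ₁ x} : ℝ) ≤
      ∏ i, ((#{v | col v = i} - #{v ∈ P.image σ₁ | col v = i}).factorial : ℝ) := by
    exact_mod_cast card_patternPerms_eqOn_le h₁.1 P
  rw [heq]
  calc (#{σ ∈ patternPerms col c | ∀ x ∈ P, σ x = σ₁ x} : ℝ) * (b / 3) ^ #P
      ≤ (∏ i, ((#{v | col v = i} - #{v ∈ P.image σ₁ | col v = i}).factorial : ℝ)) *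
          ∏ i, (b / 3) ^ #{v ∈ P.image σ₁ | col v = i} := by
        rw [prod_pow_eq_pow_sum, ← hPcard]
        gcongr
    _ ≤ ∏ i, ((#{v | col v = i}).factorial : ℝ) := by
        rw [← prod_mul_distrib]
        exact prod_le_prod (fun i _ ↦ by positivity) fun i _ ↦
          factorial_sub_mul_pow_le hb (hcol i)
            (card_le_card (filter_subset_filter _ (subset_univ _)))
    _ ≤ #(patternPerms col c) := by exact_mod_cast card_patternPerms_ge h₁.1

end PatternPerm

/-! ### Spreadness of the candidate cycles -/

section CycleEdges

variable {n : ℕ} [NeZero n]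

/-- The edges of the closed walk `σ 0, σ 1, …, σ (n - 1), σ 0`. -/
def cycleEdges (σ : Equiv.Perm (Fin n)) : Finset (Sym2 (Fin n)) :=
  univ.image fun i ↦ s(σ i, σ (i + 1))

theorem card_cycleEdges_le (σ : Equiv.Perm (Fin n)) : #(cycleEdges σ) ≤ n :=
  card_image_le.trans (by simp)

open scoped Fin.NatCast Fin.CommRing in
/-- A function on `Fin n` is determined on `I ∪ (I + 1)` by its increments at the points of `I` and
its values at the starting points of the runs of `I`. -/
theorem eqOn_of_eqOn_runStarts {I : Finset (Fin n)} {i₀ : Fin n} (hi₀ : i₀ ∉ I)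
    {τ τ' d : Fin n → Fin n} (hτ : ∀ i ∈ I, τ (i + 1) = τ i + d i)
    (hτ' : ∀ i ∈ I, τ' (i + 1) = τ' i + d i) (h : ∀ i ∈ I \ I.image (· + 1), τ i = τ' i) :
    ∀ x ∈ I ∪ I.image (· + 1), τ x = τ' x := by
  -- Walking round from just after the gap i₀, every run is met at its start.
  have key : ∀ j : ℕ, i₀ + 1 + (j : Fin n) ∈ I ∪ I.image (· + 1) →
      τ (i₀ + 1 + (j : Fin n)) = τ' (i₀ + 1 + (j : Fin n)) := by
    intro j
    induction j with
    | zero =>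
      intro hx
      simp only [Nat.cast_zero, add_zero] at hx ⊢
      refine h _ ?_
      have : i₀ + 1 ∉ I.image (· + 1) := by simpa using hi₀
      grind
    | succ j ih =>
      intro hx
      rw [Nat.cast_succ, ← add_assoc] at hx ⊢
      by_cases hmem : i₀ + 1 + (j : Fin n) + 1 ∈ I.image (· + 1)
      · have hI : i₀ + 1 + (j : Fin n) ∈ I := by simpa using hmem
        rw [hτ _ hI, hτ' _ hI, ih (mem_union_left _ hI)]
      · exact h _ (by grind)
  intro x hx
  have := key (x - (i₀ + 1)).val
  rw [Fin.cast_val_eq_self, add_sub_cancel] at this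
  exact this hx

/-- The ends of an edge of the cycle occupy cyclically consecutive positions, so one bit records the
increment. -/
theorem symm_add_one_of_mem_cycleEdges {σ σ₀ : Equiv.Perm (Fin n)} {i : Fin n}
    (h : s(σ₀ i, σ₀ (i + 1)) ∈ cycleEdges σ) :
    σ.symm (σ₀ (i + 1)) = σ.symm (σ₀ i) +
      if σ.symm (σ₀ (i + 1)) = σ.symm (σ₀ i) + 1 then 1 else -1 := by
  obtain ⟨j, -, hj⟩ := mem_image.1 h
  rw [Sym2.eq_iff] at hj
  split_ifs with h1
  · exact h1
  · rcases hj with ⟨h2, h3⟩ | ⟨h2, h3⟩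
    · rw [← h2, ← h3] at h1
      simp at h1
    · rw [← h2, ← h3]
      simp

variable {κ : Type*} [DecidableEq κ] [Fintype κ]

/-- Viewed along one cycle σ₀ containing S, the edges form runs. Any other such σ is described by
the positions of the run starts J and a direction for each edge: n^|J| 2^|S| codes, each fixing σ at
|S| + |J| points. A full cycle would have no run start, hence |S| < n. -/
theorem card_patternPerms_subset_cycleEdges_le {col c : Fin n → κ} {δ : ℝ} (hδ0 : 0 < δ)
    (hδ3 : δ ≤ 3) (hcol : ∀ i, δ * n ≤ #{v | col v = i}) (S : Finset (Sym2 (Fin n)))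
    (hS : #S < n) :
    (#{σ ∈ patternPerms col c | S ⊆ cycleEdges σ} : ℝ) ≤
      (18 / δ ^ 2 / n) ^ #S * #(patternPerms col c) := by
  have hn : (0 : ℝ) < n := by exact_mod_cast Nat.pos_of_ne_zero (NeZero.ne n)
  rcases eq_empty_or_nonempty {σ ∈ patternPerms col c | S ⊆ cycleEdges σ} with h0 | ⟨σ₀, h₀⟩
  · rw [h0, card_empty, Nat.cast_zero]; positivity
  rw [mem_filter] at h₀
  obtain ⟨I, -, hIinj, hIS⟩ := exists_subset_injOn_image_eq_of_surjOn
    (f := fun i : Fin n ↦ s(σ₀ i, σ₀ (i + 1))) Set.univ S (by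
      intro e he
      obtain ⟨i, -, hi⟩ := mem_image.1 (h₀.2 he)
      exact ⟨i, trivial, hi⟩)
  have hIcard : #I = #S := by rw [← hIS, card_image_of_injOn hIinj]
  obtain ⟨i₀, hi₀⟩ : ∃ i₀, i₀ ∉ I := by
    by_contra! h
    rw [← hIcard, eq_univ_of_forall h] at hS
    simp at hS
  set J := I \ I.image (· + 1) with hJ
  set U := I ∪ I.image (· + 1) with hU
  have hUcard : #U = #S + #J := by
    have h1 : U = I.image (· + 1) ∪ J := by grind
    rw [h1, card_union_of_disjoint disjoint_sdiff, card_image_of_injective _ (add_left_injective 1),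
      hIcard]
  have hJcard : #J ≤ #S := by rw [← hIcard]; exact card_le_card sdiff_subset
  set b := δ * n with hb
  have hb0 : 0 < b := by positivity
  let code : Equiv.Perm (Fin n) → (J → Fin n) × (I → Bool) := fun σ ↦
    (fun x ↦ σ.symm (σ₀ x), fun i ↦ decide (σ.symm (σ₀ (i + 1)) = σ.symm (σ₀ i) + 1))
  have hfiber : ∀ y, (#{σ ∈ {σ ∈ patternPerms col c | S ⊆ cycleEdges σ} | code σ = y} : ℝ) ≤
      #(patternPerms col c) / (b / 3) ^ (#S + #J) := by
    intro y
    rcases eq_empty_or_nonempty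
      {σ ∈ {σ ∈ patternPerms col c | S ⊆ cycleEdges σ} | code σ = y} with h0 | ⟨σ₁, h₁⟩
    · rw [h0, card_empty, Nat.cast_zero]; positivity
    simp only [mem_filter] at h₁
    rw [le_div_iff₀ (by positivity)]
    have hPcard : #(U.image fun x ↦ σ₁.symm (σ₀ x)) = #S + #J := by
      exact (card_image_of_injective _ (σ₁.symm.injective.comp σ₀.injective)).trans hUcard
    rw [← hPcard]
    refine le_trans ?_ (card_patternPerms_eqOn_mul_pow_le hb0.le hcol
      (U.image fun x ↦ σ₁.symm (σ₀ x)) σ₁)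
    gcongr
    intro σ hσ
    simp only [mem_filter] at hσ ⊢
    refine ⟨hσ.1.1, fun z hz ↦ ?_⟩
    obtain ⟨x, hx, rfl⟩ := mem_image.1 hz
    have hcode : code σ = code σ₁ := hσ.2.trans h₁.2.symm
    have hsign : ∀ i ∈ I, σ.symm (σ₀ (i + 1)) = σ.symm (σ₀ i) + 1 ↔
        σ₁.symm (σ₀ (i + 1)) = σ₁.symm (σ₀ i) + 1 := fun i hi ↦ by
      have := congrFun (congrArg Prod.snd hcode) ⟨i, hi⟩
      simpa [code] using this
    have hedge : ∀ i ∈ I, s(σ₀ i, σ₀ (i + 1)) ∈ S := fun i hi ↦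
      hIS ▸ mem_image_of_mem _ hi
    have hagree := eqOn_of_eqOn_runStarts hi₀
      (τ := fun x ↦ σ.symm (σ₀ x)) (τ' := fun x ↦ σ₁.symm (σ₀ x))
      (d := fun i ↦ if σ₁.symm (σ₀ (i + 1)) = σ₁.symm (σ₀ i) + 1 then 1 else -1)
      (fun i hi ↦ by
        have h := symm_add_one_of_mem_cycleEdges (hσ.1.2 (hedge i hi))
        simpa only [hsign i hi] using h)
      (fun i hi ↦ symm_add_one_of_mem_cycleEdges (h₁.1.2 (hedge i hi)))
      (fun i hi ↦ congrFun (congrArg Prod.fst hcode) ⟨i, hi⟩) x hx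
    rw [← hagree, Equiv.apply_symm_apply, hagree, Equiv.apply_symm_apply]
  have hsum : (#{σ ∈ patternPerms col c | S ⊆ cycleEdges σ} : ℝ) ≤
      (n ^ #J * 2 ^ #S) * (#(patternPerms col c) / (b / 3) ^ (#S + #J)) := by
    rw [card_eq_sum_card_fiberwise (f := code) (t := univ) fun _ _ ↦ mem_univ _, Nat.cast_sum]
    refine (sum_le_sum fun y _ ↦ hfiber y).trans_eq ?_
    rw [sum_const, nsmul_eq_mul, card_univ, Fintype.card_prod, Fintype.card_fun, Fintype.card_fun]
    simp [hIcard]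
  refine hsum.trans ?_
  have h3δ : 1 ≤ 3 / δ := by rwa [one_le_div hδ0]
  -- The n^|J| choices of run starts cancel against b^|J| = (δn)^|J|, leaving only n^(-|S|).
  calc (n ^ #J * 2 ^ #S) * (#(patternPerms col c) / (b / 3) ^ (#S + #J))
      = (2 * (3 / δ) / n) ^ #S * (3 / δ) ^ #J * #(patternPerms col c) := by
        rw [hb, pow_add]
        simp only [mul_pow, div_pow]
        field_simp
    _ ≤ (2 * (3 / δ) / n) ^ #S * (3 / δ) ^ #S * #(patternPerms col c) := by gcongr
    _ = (18 / δ ^ 2 / n) ^ #S * #(patternPerms col c) := by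
        rw [← mul_pow]
        congr 2
        field_simp
        norm_num

theorem isSpread_cycleEdges {col : Fin n → κ} (c : Fin n → κ) {δ : ℝ} (hδ0 : 0 < δ) (hδ3 : δ ≤ 3)
    (hcol : ∀ i, δ * n ≤ #{v | col v = i}) :
    IsSpread (patternPerms col c) cycleEdges (36 / δ ^ 2 / n) #(patternPerms col c) := by
  have hn : (0 : ℝ) < n := by exact_mod_cast Nat.pos_of_ne_zero (NeZero.ne n)
  have hC : 36 / δ ^ 2 / n = 2 * (18 / δ ^ 2 / n) := by ring
  have hpow : ∀ m : ℕ, (18 / δ ^ 2 / n) ^ m ≤ (36 / δ ^ 2 / n) ^ m := fun m ↦ by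
    gcongr
    norm_num
  intro S
  rcases lt_trichotomy #S n with hS | hS | hS
  · exact (card_patternPerms_subset_cycleEdges_le hδ0 hδ3 hcol S hS).trans (by gcongr; norm_num)
  · obtain ⟨e, he⟩ : S.Nonempty := by
      rw [← card_pos, hS]; exact_mod_cast hn
    have hcard : #S = #(S.erase e) + 1 := (card_erase_add_one he).symm
    have h1 := card_patternPerms_subset_cycleEdges_le (c := c) hδ0 hδ3 hcol (S.erase e) (by omega)
    have h2 : (#{σ ∈ patternPerms col c | S ⊆ cycleEdges σ} : ℝ) ≤
        #{σ ∈ patternPerms col c | S.erase e ⊆ cycleEdges σ} := by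
      gcongr
      exact erase_subset _ _
    -- For |S| = n one edge was dropped, losing a factor of order n; doubling 18 to 36 gains 2^n,
    -- which absorbs it.
    have hone : (1 : ℝ) ≤ 2 ^ #S * (18 / δ ^ 2 / n) := by
      have h18 : 1 ≤ 18 / δ ^ 2 := by
        rw [one_le_div (by positivity)]
        nlinarith
      have h2n : (n : ℝ) ≤ 2 ^ #S := by
        rw [hS]; exact_mod_cast Nat.lt_two_pow_self.le
      calc (1 : ℝ) = n * (1 / n) := by field_simp
        _ ≤ _ := by gcongr
    refine h2.trans (h1.trans ?_)
    gcongr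
    calc (18 / δ ^ 2 / n) ^ #(S.erase e)
        ≤ (18 / δ ^ 2 / n) ^ #(S.erase e) * (2 ^ #S * (18 / δ ^ 2 / n)) :=
          le_mul_of_one_le_right (by positivity) hone
      _ = (36 / δ ^ 2 / n) ^ #S := by
          rw [hC, mul_pow, hcard]
          ring
  · rw [filter_false_of_mem fun σ _ h ↦ ?_]
    · simp only [card_empty, Nat.cast_zero]
      positivity
    · exact absurd (card_le_card h) (by have := card_cycleEdges_le σ; omega)

end CycleEdges

/-! ### From binomial random graphs to weighted sums -/

open ProbabilityTheory MeasureTheory in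
open scoped Classical in
theorem setBernoulli_real_eq_bernoulliExpect {ι : Type*} [Finite ι] (p : unitInterval)
    (u : Finset ι) (B : Set (Set ι)) :
    (setBernoulli (u : Set ι) p).real B =
      bernoulliExpect p u fun W ↦ if (W : Set ι) ∈ B then 1 else 0 := by
  have hB : ({s ∈ B | s ⊆ u} : Set (Set ι)) =
      ⋃ W ∈ u.powerset.filter (fun W : Finset ι ↦ (W : Set ι) ∈ B), {(W : Set ι)} := by
    ext s
    simp only [Set.mem_ofPred_eq, mem_filter, mem_powerset, Set.mem_iUnion, Set.mem_singleton_iff,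
      exists_prop]
    constructor
    · rintro ⟨hs, hsu⟩
      obtain ⟨W, rfl⟩ := (u.finite_toSet.subset hsu).exists_finset_coe
      exact ⟨W, ⟨by exact_mod_cast hsu, hs⟩, rfl⟩
    · rintro ⟨W, ⟨hW, hWB⟩, rfl⟩
      exact ⟨hWB, by exact_mod_cast hW⟩
  rw [measureReal_def, setBernoulli_apply_eq_apply_subsets, ← measureReal_def, hB,
    measureReal_biUnion_finset, sum_filter, bernoulliExpect]
  · refine sum_congr rfl fun W hW ↦ ?_
    have hWu := mem_powerset.1 hW
    split_ifs
    · rw [setBernoulli_real_singleton p (by exact_mod_cast hWu) u.finite_toSet, ← coe_sdiff,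
        Set.ncard_coe_finset, Set.ncard_coe_finset, card_sdiff_of_subset hWu, mul_one]
    · rw [mul_zero]
  · intro W _ W' _ hne
    simpa [Function.onFun] using hne
  · intro W _
    exact measurableSet_singleton _

open MeasureTheory in
open scoped Classical in
theorem binomialRandom_real_eq_bernoulliExpect {V : Type*} [Fintype V] [DecidableEq V]
    (p : unitInterval) (A : Set (SimpleGraph V)) :
    (SimpleGraph.binomialRandom V p).real A =
      bernoulliExpect p ({e | ¬ e.IsDiag} : Finset (Sym2 V))
        fun W ↦ if SimpleGraph.fromEdgeSet (W : Set (Sym2 V)) ∈ A then 1 else 0 := by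
  have hu : (Sym2.diagSet : Set (Sym2 V))ᶜ = (({e | ¬ e.IsDiag} : Finset (Sym2 V)) : Set _) := by
    ext e
    simp
  rw [measureReal_def, SimpleGraph.binomialRandom_apply', ← measureReal_def, hu,
    setBernoulli_real_eq_bernoulliExpect]
  refine sum_congr rfl fun W hW ↦ ?_
  have hW' : Disjoint (W : Set (Sym2 V)) Sym2.diagSet := by
    rw [← Set.subset_compl_iff_disjoint_right, hu]
    exact_mod_cast mem_powerset.1 hW
  congr 1
  refine if_congr ⟨?_, ?_⟩ rfl rfl
  · rintro ⟨G, hG, hGW⟩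
    rwa [← hGW, SimpleGraph.fromEdgeSet_edgeSet]
  · intro h
    exact ⟨_, h, by rw [SimpleGraph.edgeSet_fromEdgeSet, sdiff_eq_left.2 hW']⟩

theorem hasColoredHamiltonCycle_of_cycleEdges {n k : ℕ} [NeZero n] (hn : 3 ≤ n)
    {G : SimpleGraph (Fin n)} {col c : Fin n → Fin k} {σ : Equiv.Perm (Fin n)}
    (hσ : σ ∈ patternPerms col c) (hG : ∀ i, G.Adj (σ i) (σ (i + 1))) :
    HasColoredHamiltonCycle G col c := by
  obtain ⟨m, rfl⟩ : ∃ m, n = m + 3 := ⟨n - 3, by omega⟩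
  let f : SimpleGraph.cycleGraph (m + 3) →g G :=
    -- `SimpleGraph.cycleGraph.cycle` visits the residues in decreasing order; the sign makes the
    -- i-th vertex σ i.
    { toFun := fun i ↦ σ (-i)
      map_rel' := by
        intro a b hab
        rw [SimpleGraph.cycleGraph_adj] at hab
        rcases hab with h | h
        · have : -b = -a + 1 := by rw [← h]; abel
          rw [this]
          exact hG _
        · have : -a = -b + 1 := by rw [← h]; abel
          rw [this]
          exact (hG _).symm }
  have hf : Function.Bijective f := σ.bijective.comp (Equiv.neg _).bijective
  refine ⟨f 0, (SimpleGraph.cycleGraph.cycle m).map f, ?_, fun i ↦ ?_⟩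
  · refine SimpleGraph.Walk.IsHamiltonianCycle.map hf ?_
    rw [SimpleGraph.Walk.isHamiltonianCycle_iff_isCycle_and_length_eq]
    exact ⟨SimpleGraph.cycleGraph.isCycle_cycle, by simp [SimpleGraph.cycleGraph.length_cycle]⟩
  · rw [SimpleGraph.Walk.getVert_map, SimpleGraph.cycleGraph.getVert_cycle i.isLt.le]
    have h1 : f ⟨(m + 3 - i) % (m + 3), Nat.mod_lt _ (by lia)⟩ = σ (- -i) := rfl
    rw [h1, neg_neg]
    exact mem_patternPerms.1 hσ i

theorem cycleEdges_subset {n : ℕ} [NeZero n] (hn : 2 ≤ n) (σ : Equiv.Perm (Fin n)) :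
    cycleEdges σ ⊆ ({e | ¬ e.IsDiag} : Finset (Sym2 (Fin n))) := by
  obtain ⟨m, rfl⟩ : ∃ m, n = m + 2 := ⟨n - 2, by omega⟩
  intro e he
  obtain ⟨i, -, rfl⟩ := mem_image.1 he
  simp

theorem binomialRandom_hasColoredHamiltonCycle_ge {n k : ℕ} [NeZero n] (hn : 3 ≤ n)
    (p : unitInterval) (col c : Fin n → Fin k) :
    1 - bernoulliExpect p ({e | ¬ e.IsDiag} : Finset (Sym2 (Fin n)))
        (uncovered (patternPerms col c) cycleEdges) ≤
      (SimpleGraph.binomialRandom (Fin n) p).real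
        {G : SimpleGraph (Fin n) | HasColoredHamiltonCycle G col c} := by
  classical
  rw [binomialRandom_real_eq_bernoulliExpect, sub_le_iff_le_add, ← bernoulliExpect_add]
  nth_rewrite 1 [← bernoulliExpect_const (p : ℝ) ({e | ¬ e.IsDiag} : Finset (Sym2 (Fin n))) 1]
  refine bernoulliExpect_mono p.2.1 p.2.2 fun W hW ↦ ?_
  unfold uncovered
  by_cases h : ∃ σ ∈ patternPerms col c, cycleEdges σ ⊆ W
  · obtain ⟨σ, hσ, hσW⟩ := h
    rw [if_pos, if_pos ⟨σ, hσ, hσW⟩, add_zero]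
    refine hasColoredHamiltonCycle_of_cycleEdges hn hσ fun i ↦ ?_
    have hi : s(σ i, σ (i + 1)) ∈ cycleEdges σ := mem_image_of_mem _ (mem_univ i)
    rw [SimpleGraph.fromEdgeSet_adj]
    refine ⟨hσW hi, ?_⟩
    simpa only [mem_filter, mem_univ, true_and, Sym2.mk_isDiag_iff] using hW (hσW hi)
  · rw [if_neg h]
    split_ifs <;> norm_num

/-! ### Limits and logarithms -/

open Filter Topology in
-- The final size m = √r grows faster than log r, making the first term vanish, and is o(r), making
-- the second vanish since (1 + 1/r)^m ≤ exp(1/m).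
theorem tendsto_failure_bound :
    Tendsto (fun r : ℕ ↦ (r : ℝ) * (1 / 4) ^ r.sqrt + ((1 + 1 / (r : ℝ)) ^ r.sqrt - 1))
      atTop (𝓝 0) := by
  have hsqrt : Tendsto Nat.sqrt atTop atTop :=
    tendsto_atTop.2 fun b ↦ (eventually_ge_atTop (b * b)).mono fun r hr ↦ Nat.le_sqrt.2 hr
  have h1 : Tendsto (fun m : ℕ ↦ 4 * (((m + 1 : ℕ) : ℝ) ^ 2 * (1 / 4) ^ (m + 1))) atTop (𝓝 0) := by
    have := (tendsto_pow_const_mul_const_pow_of_abs_lt_one 2 (r := 1 / 4)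
      (by rw [abs_lt]; norm_num)).comp (tendsto_add_atTop_nat 1)
    simpa using this.const_mul 4
  have h2 : Tendsto (fun m : ℕ ↦ Real.exp (1 / (m : ℝ)) - 1) atTop (𝓝 0) := by
    have := (Real.continuous_exp.tendsto 0).comp (tendsto_one_div_atTop_nhds_zero_nat (𝕜 := ℝ))
    simpa using this.sub_const 1
  have h3 := (h1.add h2).comp hsqrt
  rw [add_zero] at h3
  refine tendsto_of_tendsto_of_tendsto_of_le_of_le' tendsto_const_nhds h3 ?_ ?_
  · refine Eventually.of_forall fun r ↦ ?_
    have : (1 : ℝ) ≤ (1 + 1 / (r : ℝ)) ^ r.sqrt :=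
      one_le_pow₀ (by have : (0 : ℝ) ≤ 1 / (r : ℝ) := by positivity
                      linarith)
    have : (0 : ℝ) ≤ (r : ℝ) * (1 / 4) ^ r.sqrt := by positivity
    linarith
  · filter_upwards [eventually_ge_atTop 1] with r hr
    have hm : 1 ≤ r.sqrt := Nat.le_sqrt.2 (by simpa using hr)
    have hr0 : (0 : ℝ) < r := by exact_mod_cast hr
    have hm0 : (0 : ℝ) < r.sqrt := by exact_mod_cast hm
    have hle : (r : ℝ) ≤ ((r.sqrt + 1 : ℕ) : ℝ) ^ 2 := by
      rw [sq]; exact_mod_cast (Nat.lt_succ_sqrt r).le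
    have hge : (r.sqrt : ℝ) * r.sqrt ≤ r := by exact_mod_cast Nat.sqrt_le r
    refine add_le_add ?_ ?_
    · calc (r : ℝ) * (1 / 4) ^ r.sqrt ≤ ((r.sqrt + 1 : ℕ) : ℝ) ^ 2 * (1 / 4) ^ r.sqrt := by gcongr
        _ = 4 * (((r.sqrt + 1 : ℕ) : ℝ) ^ 2 * (1 / 4) ^ (r.sqrt + 1)) := by ring
    · gcongr
      calc (1 + 1 / (r : ℝ)) ^ r.sqrt ≤ Real.exp (1 / r) ^ r.sqrt := by
            gcongr
            rw [add_comm]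
            exact Real.add_one_le_exp _
        _ = Real.exp (r.sqrt * (1 / r)) := by rw [← Real.exp_nat_mul]
        _ ≤ Real.exp (1 / r.sqrt) := by
            gcongr
            rw [mul_one_div, div_le_div_iff₀ hr0 hm0, one_mul]
            exact hge

theorem clog_two_le_four_mul_log {n : ℕ} (hn : 2 ≤ n) : (Nat.clog 2 n : ℝ) ≤ 4 * Real.log n := by
  have h1 : 2 ^ (Nat.clog 2 n - 1) < n := Nat.pow_pred_clog_lt_self (by norm_num) (by omega)
  have hc : 1 ≤ Nat.clog 2 n := Nat.clog_pos (by norm_num) hn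
  have h2 : ((Nat.clog 2 n - 1 : ℕ) : ℝ) * Real.log 2 ≤ Real.log n := by
    rw [← Real.log_pow]
    exact Real.log_le_log (by positivity) (by exact_mod_cast h1.le)
  have h3 : Real.log 2 ≤ Real.log n := Real.log_le_log (by norm_num) (by exact_mod_cast hn)
  rw [Nat.cast_sub hc, Nat.cast_one] at h2
  have h4 := Real.log_two_gt_d9
  have h5 : (1 : ℝ) ≤ Nat.clog 2 n := by exact_mod_cast hc
  nlinarith

/-! ### Choice of parameters and conclusion -/

/-- The failure probability for a fixed number of vertices. -/
theorem bernoulliExpect_uncovered_cycleEdges_le {n k : ℕ} (hn : 3 ≤ n) [NeZero n]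
    {col c : Fin n → Fin k} {δ K : ℝ} (hδ0 : 0 < δ) (hδ3 : δ ≤ 3)
    (hcol : ∀ i, δ * n ≤ #{v | col v = i})
    (hc : ∀ i, #{x | c x = i} = #{v | col v = i})
    (hK : 260 * (36 / δ ^ 2) ≤ K) (hlarge : 256 * (36 / δ ^ 2) * (Real.log n / n) ≤ 1) :
    bernoulliExpect (edgeProb K n) ({e | ¬ e.IsDiag} : Finset (Sym2 (Fin n)))
        (uncovered (patternPerms col c) cycleEdges) ≤
      (Nat.clog 2 n : ℝ) * (1 / 4) ^ (Nat.clog 2 n).sqrt +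
        ((1 + 1 / (Nat.clog 2 n : ℝ)) ^ (Nat.clog 2 n).sqrt - 1) := by
  set C := 36 / δ ^ 2 with hC
  set r := Nat.clog 2 n with hr
  have hC0 : 0 < C := by positivity
  have hn0 : (0 : ℝ) < n := by exact_mod_cast (by omega : 0 < n)
  have hr1 : 1 ≤ r := Nat.clog_pos (by norm_num) (by omega)
  have hr1' : (1 : ℝ) ≤ r := by exact_mod_cast hr1
  have hq0 : 0 < C / n := by positivity
  have hrlog : (r : ℝ) ≤ 4 * Real.log n := clog_two_le_four_mul_log (by omega)
  have hrq : 64 * (r * (C / n)) ≤ 1 := by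
    calc 64 * (r * (C / n)) ≤ 64 * (4 * Real.log n * (C / n)) := by gcongr
      _ = 256 * C * (Real.log n / n) := by ring
      _ ≤ 1 := hlarge
  have hq1 : 64 * (C / n) ≤ 1 := by
    refine le_trans ?_ hrq
    gcongr
    exact le_mul_of_one_le_left hq0.le hr1'
  have hN : (0 : ℝ) < #(patternPerms col c) := by
    exact_mod_cast card_pos.2 (patternPerms_nonempty hc)
  have hp0 : 0 < r * (C / n) := by positivity
  have hp1 : r * (C / n) ≤ 1 := by linarith
  -- r rounds of density 64q and a last one of density rq give at most 65rq; r ≤ 4 log n explains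
  -- the constant 260.
  have hmain := bernoulliExpect_uncovered_le (m := r.sqrt) hq0 hq1 hN hp0 hp1 r
    (isSpread_cycleEdges c hδ0 hδ3 hcol) (fun σ _ ↦ cycleEdges_subset (by omega) σ)
    (fun σ _ ↦ (card_cycleEdges_le σ).trans <|
      (Nat.le_pow_clog (by norm_num) n).trans <|
        Nat.le_mul_of_pos_left _ (Nat.le_sqrt.2 (by simpa using hr1)))
  rw [div_self hN.ne', sub_self, zero_add,
    show C / n / (r * (C / n)) = 1 / (r : ℝ) by field_simp] at hmain
  obtain ⟨hd0, hd1, hd2⟩ := roundsDensity_mem (by positivity) hq1 hp0.le hp1 r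
  refine (bernoulliExpect_anti hd0 ?_ (edgeProb K n).2.2 fun W W' ↦ ?_).trans hmain
  · rw [edgeProb, Set.coe_projIcc]
    refine le_max_of_le_right (le_min hd1 (hd2.trans ?_))
    have hlog : 0 ≤ Real.log n := Real.log_natCast_nonneg n
    calc r * (64 * (C / n)) + r * (C / n) = 65 * r * C / n := by ring
      _ ≤ 65 * (4 * Real.log n) * C / n := by gcongr
      _ = 260 * C * Real.log n / n := by ring
      _ ≤ K * Real.log n / n := by gcongr
  · exact uncovered_le_of_imp fun ⟨σ, hσ, hσW⟩ ↦ ⟨σ, hσ, hσW.trans subset_union_left⟩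

theorem theorem2 (k : ℕ) (β : Fin k → ℝ) (hpos : ∀ i, 0 < β i) (hsum : ∑ i, β i = 1) :
    ∃ K₀ : ℝ, ∀ K : ℝ, K₀ ≤ K → ∀ ε : ℝ, 0 < ε → ∃ n₀ : ℕ, ∀ n : ℕ, n₀ ≤ n →
      ∀ col : Fin n → Fin k,
        (∀ i : Fin k, |((Finset.univ.filter (fun v => col v = i)).card : ℝ) - β i * n| < 1) →
        ∀ c : Fin n → Fin k,
          (∀ i : Fin k, (Finset.univ.filter (fun t => c t = i)).card =
            (Finset.univ.filter (fun v => col v = i)).card) →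
          1 - ε ≤ (SimpleGraph.binomialRandom (Fin n) (edgeProb K n)).real
            {G : SimpleGraph (Fin n) | HasColoredHamiltonCycle G col c} := by
  have hne : (univ : Finset (Fin k)).Nonempty := by
    by_contra h
    rw [not_nonempty_iff_eq_empty.1 h, sum_empty] at hsum
    exact zero_ne_one hsum
  obtain ⟨j, -, hj⟩ := exists_min_image univ β hne
  have hβ1 : β j ≤ 1 := hsum ▸ single_le_sum (fun i _ ↦ (hpos i).le) (mem_univ j)
  -- Half the least proportion: once δn ≥ 1, the rounding error is absorbed, as 2δn - 1 ≥ δn.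
  set δ := β j / 2 with hδ
  have hδ0 : 0 < δ := half_pos (hpos j)
  refine ⟨260 * (36 / δ ^ 2), fun K hK ε hε ↦ ?_⟩
  have hlog : Filter.Tendsto (fun n : ℕ ↦ 256 * (36 / δ ^ 2) * (Real.log n / n)) Filter.atTop
      (nhds 0) := by
    have := Real.isLittleO_log_id_atTop.tendsto_div_nhds_zero.comp
      (tendsto_natCast_atTop_atTop (R := ℝ))
    simpa using this.const_mul (256 * (36 / δ ^ 2))
  have hclog : Filter.Tendsto (Nat.clog 2) Filter.atTop Filter.atTop :=
    Filter.tendsto_atTop.2 fun b ↦ (Filter.eventually_ge_atTop (2 ^ b)).mono fun n hn ↦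
      (Nat.pow_le_pow_iff_right (by norm_num : 1 < 2)).1
        (hn.trans (Nat.le_pow_clog (by norm_num) n))
  obtain ⟨n₀, hn₀⟩ := Filter.eventually_atTop.1
    ((hlog.eventually (ge_mem_nhds zero_lt_one)).and
      (((tendsto_failure_bound.comp hclog).eventually (ge_mem_nhds hε)).and
        ((Filter.eventually_ge_atTop 3).and (Filter.eventually_ge_atTop ⌈1 / δ⌉₊))))
  refine ⟨n₀, fun n hn col hcol c hc ↦ ?_⟩
  obtain ⟨hlarge, hfail, hn3, hnδ⟩ := hn₀ n hn
  have : NeZero n := ⟨by omega⟩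
  have hcol' : ∀ i, δ * n ≤ #{v | col v = i} := by
    intro i
    have h1 := (abs_lt.1 (hcol i)).1
    have h2 : β j * n ≤ β i * n := by gcongr; exact hj i (mem_univ i)
    have h3 : 1 ≤ δ * n := by
      rw [← div_le_iff₀' hδ0]
      exact Nat.ceil_le.1 hnδ
    have h4 : β j = 2 * δ := by rw [hδ]; ring
    rw [h4] at h2
    linarith
  have h := bernoulliExpect_uncovered_cycleEdges_le hn3 hδ0 (by linarith) hcol' hc hK hlarge
  refine le_trans ?_ (binomialRandom_hasColoredHamiltonCycle_ge hn3 (edgeProb K n) col c)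
  have hfail' := h.trans hfail
  linarith
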